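/- Let $g:\mathbb R\to\mathbb R$ be the density generator of an $(n+1)$-dimensional spherical distribution, i.e. $g$ is measurable, $g\ge 0$ on $[0,\infty)$ and $\int_{\mathbb R^{n+1}} g(\mathbf w'\mathbf w)\,d\mathbf w=1$. Put $g^{(n)}(u)=\int_{\mathbb R} g(u+t^2)\,dt$ and $F_{g_q}(s)=\frac{1}{g^{(n)}(q)}\int_{-\infty}^{s} g(q+t^2)\,dt$. For $\boldsymbol\mu,\boldsymbol\alpha_w\in\mathbb R^n$ and a symmetric positive definite $n\times n$ matrix $\mathbf\Omega$, write $\mathbf X\sim SE_n(\boldsymbol\mu,\mathbf\Omega,\boldsymbol\alpha_w,g)$ if $\mathbf X$ has the density $$2|\mathbf\Omega|^{-1/2}\,g^{(n)}(q(\mathbf x))\,F_{g_{q(\mathbf x)}}\big(\boldsymbol\alpha_w'(\mathbf x-\boldsymbol\mu)\big),\qquad q(\mathbf x)=(\mathbf x-\boldsymbol\mu)'\mathbf\Omega^{-1}(\mathbf x-\boldsymbol\mu),$$ and let $\boldsymbol\delta_w=\mathbf\Omega\boldsymbol\alpha_w/\sqrt{1+\boldsymbol\alpha_w'\mathbf\Omega\boldsymbol\alpha_w}$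 be its skewness vector. Real random variables satisfy $U\le_{cx}V$ if $E f(U)\le E f(V)$ for every convex $f:\mathbb R\to\mathbb R$ such that both $f(U)$ and $f(V)$ are integrable. Random vectors in $\mathbb R^n$ satisfy $\mathbf X\le_{plcx}\mathbf Y$ if $\mathbf a'\mathbf X\le_{cx}\mathbf a'\mathbf Y$ for every $\mathbf a\in\mathbb R^n$ with nonnegative coordinates. An $n\times n$ matrix $\mathbf A$ is copositive if $\mathbf x'\mathbf A\mathbf x\ge 0$ for every $\mathbf x\in\mathbb R^n$ with nonnegative coordinates. **Theorem 3.11.** Let $\mathbf X\sim SE_n(\boldsymbol\mu^x,\mathbf\Omega^x,\boldsymbol\alpha_w^x,g)$ and $\mathbf Y\sim SE_n(\boldsymbol\mu^y,\mathbf\Omega^y,\boldsymbol\alpha_w^y,g)$, with skewness vectors $\boldsymbol\delta_w^x$ and $\boldsymbol\delta_w^y$. (1) If $\boldsymbol\mu^x=\boldsymbol\mu^y$, $\boldsymbol\delta_w^x=\boldsymbol\delta_w^y$ and $\mathbf\Omega^y-\mathbf\Omega^x$ is copositive, then $\mathbf X\le_{plcx}\mathbf Y$. (2) Suppose that $\mathbf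 X$ and $\mathbf Y$ have finite means and that each coordinate of $\mathbf X$ and of $\mathbf Y$ has support $\mathbb R$. If $\mathbf X\le_{plcx}\mathbf Y$ and $\boldsymbol\mu^x=\boldsymbol\mu^y$, then $\boldsymbol\delta_w^x=\boldsymbol\delta_w^y$ and $\mathbf\Omega^y-\mathbf\Omega^x$ is copositive. -/

import Mathlib

open MeasureTheory ProbabilityTheory Matrix

noncomputable section

namespace SkewElliptical

/-- `g` is the density generator of an `m`-dimensional spherical distribution: it is measurable,
nonnegative on `[0, ∞)`, and `w ↦ g (w'w)` is a probability density on `ℝᵐ`. -/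
structure IsDensityGenerator (m : ℕ) (g : ℝ → ℝ) : Prop where
  measurable : Measurable g
  nonneg : ∀ u, 0 ≤ u → 0 ≤ g u
  lintegral_eq_one : ∫⁻ w : Fin m → ℝ, ENNReal.ofReal (g (w ⬝ᵥ w)) = 1

/-- The generator of the marginal distribution with one dimension less:
`u ↦ ∫ g (u + t²) dt`. If `g = g^{(n+1)}` this is `g^{(n)}`. -/
def marginalGenerator (g : ℝ → ℝ) (u : ℝ) : ℝ :=
  ∫ t : ℝ, g (u + t ^ 2)

/-- The distribution function `F_{g_q}` of the univariate elliptical distribution whose generator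
is the conditional generator `g_q(v) = g^{(n+1)}(q + v) / g^{(n)}(q)`: this is the law of the
remaining coordinate of an `(n+1)`-dimensional spherical vector given that the other `n`
coordinates have squared length `q`. -/
def conditionalCDF (g : ℝ → ℝ) (q s : ℝ) : ℝ :=
  (∫ t in Set.Iic s, g (q + t ^ 2)) / marginalGenerator g q

/-- The skew-elliptical density
`2 |Ω|^{-1/2} g^{(n)}(q(x)) F_{g_{q(x)}}(α'(x - μ))`, where `q(x) = (x - μ)' Ω⁻¹ (x - μ)`
and `g = g^{(n+1)}`. -/
def pdf {n : ℕ} (μ : Fin n → ℝ) (Ω : Matrix (Fin n) (Fin n) ℝ) (α : Fin n → ℝ) (g : ℝ → ℝ)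
    (x : Fin n → ℝ) : ℝ :=
  2 * (Real.sqrt Ω.det)⁻¹ * marginalGenerator g ((x - μ) ⬝ᵥ (Ω⁻¹ *ᵥ (x - μ))) *
    conditionalCDF g ((x - μ) ⬝ᵥ (Ω⁻¹ *ᵥ (x - μ))) (α ⬝ᵥ (x - μ))

/-- The skew-elliptical distribution `SE_n(μ, Ω, α_w, g^{(n+1)})` on `ℝⁿ`. -/
def law {n : ℕ} (μ : Fin n → ℝ) (Ω : Matrix (Fin n) (Fin n) ℝ) (α : Fin n → ℝ) (g : ℝ → ℝ) :
    Measure (Fin n → ℝ) :=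
  volume.withDensity fun x => ENNReal.ofReal (pdf μ Ω α g x)

/-- The skewness vector `δ_w = ω δ = Ω α_w / (1 + α_w' Ω α_w)^{1/2}`, i.e. the coefficient of
`|U₀|` in the additive representation `X = μ + δ_w |U₀| + ω Δ U₁`. Here
`ω = diag(√Ω₁₁, …, √Ωₙₙ)`, and `δ = Ω̄ α / (1 + α' Ω̄ α)^{1/2}` with `Ω̄ = ω⁻¹ Ω ω⁻¹`
and `α = ω α_w`. -/
def skewness {n : ℕ} (Ω : Matrix (Fin n) (Fin n) ℝ) (α : Fin n → ℝ) : Fin n → ℝ :=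
  (Real.sqrt (1 + α ⬝ᵥ (Ω *ᵥ α)))⁻¹ • (Ω *ᵥ α)

/-- A matrix `A` is copositive if `x'Ax ≥ 0` for all `x ≥ 0`. -/
def IsCopositive {n : ℕ} (A : Matrix (Fin n) (Fin n) ℝ) : Prop :=
  ∀ x : Fin n → ℝ, (∀ i, 0 ≤ x i) → 0 ≤ x ⬝ᵥ (A *ᵥ x)

/-- Convex order `X ≤_cx Y` of real random variables: `E f(X) ≤ E f(Y)` for all convex
`f : ℝ → ℝ` for which both expectations exist. -/
def ConvexOrder {S T : Type*} [MeasurableSpace S] [MeasurableSpace T]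
    (P : Measure S) (Q : Measure T) (X : S → ℝ) (Y : T → ℝ) : Prop :=
  ∀ f : ℝ → ℝ, ConvexOn ℝ Set.univ f →
    Integrable (fun s => f (X s)) P → Integrable (fun t => f (Y t)) Q →
      ∫ s, f (X s) ∂P ≤ ∫ t, f (Y t) ∂Q

/-- Positive-linear-convex order `X ≤_plcx Y`: `a'X ≤_cx a'Y` for all `a ∈ ℝⁿ` with
nonnegative coordinates. -/
def PosLinearConvexOrder {n : ℕ} {S T : Type*} [MeasurableSpace S] [MeasurableSpace T]
    (P : Measure S) (Q : Measure T) (X : S → Fin n → ℝ) (Y : T → Fin n → ℝ) : Prop :=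
  ∀ a : Fin n → ℝ, (∀ i, 0 ≤ a i) →
    ConvexOrder P Q (fun s => a ⬝ᵥ X s) (fun t => a ⬝ᵥ Y t)

end SkewElliptical

end

noncomputable section

namespace SkewElliptical


/-! A skew-elliptical vector is an affine image of the last `n` coordinates of a spherical vector in
`ℝⁿ⁺¹` conditioned on a half-space (`law_eq_map`). Rotating the half-space to `w₀ ≥ 0` shows that,
for `a ≠ 0`, `a'X` is distributed as `a'μ + (a'δ_w) V + s U`, with `V > 0` almost surely, the pair
`(V, U)` independent of the parameters and invariant in law under `U ↦ -U`, and `s > 0`, `s² = a'Ωa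
- (a'δ_w)²` (`map_dotProduct_law`).

When `μ` and `δ_w` agree, only `s` differs, and copositivity says that it is larger for `Y`. By the
symmetry of `U` only the even part in `s` of `f` counts, and it increases with `s ≥ 0` when `f` is
convex (`integral_convex_mono`).

Conversely, the convex functions `x` and `-x` force equal means, and `E V > 0` then gives equal
`δ_w`. If `s` were larger for `X`, a strictly convex function of linear growth would reverse the
order strictly. -/

lemma measurable_of_convexOn {f : ℝ → ℝ} (hf : ConvexOn ℝ Set.univ f) : Measurable f :=
  (continuousOn_univ.mp (hf.continuousOn isOpen_univ)).measurable

/-- The even part of a convex function about a point grows with the distance from the point. -/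
lemma convexOn_add_reflect_le {f : ℝ → ℝ} (hf : ConvexOn ℝ Set.univ f) (c u : ℝ) {s t : ℝ}
    (hs : 0 ≤ s) (hst : s ≤ t) : f (c + s * u) + f (c - s * u) ≤ f (c + t * u) + f (c - t * u) := by
  rcases (hs.trans hst).eq_or_lt with ht | ht
  · obtain rfl : s = t := by linarith
    rfl
  -- The points `c ± s * u` are convex combinations of `c ± t * u` with these two weights, in
  -- opposite orders; the two convexity inequalities add up to the claim.
  have ha : 0 ≤ (t + s) / (2 * t) := by positivity
  have hb : 0 ≤ (t - s) / (2 * t) := div_nonneg (by linarith) (by linarith)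
  have hab : (t + s) / (2 * t) + (t - s) / (2 * t) = 1 := by field_simp; ring
  have h1 := hf.2 (Set.mem_univ (c + t * u)) (Set.mem_univ (c - t * u)) ha hb hab
  have h2 := hf.2 (Set.mem_univ (c + t * u)) (Set.mem_univ (c - t * u)) hb ha (by linarith)
  simp only [smul_eq_mul] at h1 h2
  have e1 : (t + s) / (2 * t) * (c + t * u) + (t - s) / (2 * t) * (c - t * u) = c + s * u := by
    field_simp; ring
  have e2 : (t - s) / (2 * t) * (c + t * u) + (t + s) / (2 * t) * (c - t * u) = c - s * u := by
    field_simp; ring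
  rw [e1] at h1
  rw [e2] at h2
  linear_combination h1 + h2 + hab * (f (c + t * u) + f (c - t * u))

lemma strictConvexOn_add_reflect_lt {f : ℝ → ℝ} (hf : StrictConvexOn ℝ Set.univ f) (c : ℝ)
    {u s t : ℝ} (hu : u ≠ 0) (hs : 0 ≤ s) (hst : s < t) :
    f (c + s * u) + f (c - s * u) < f (c + t * u) + f (c - t * u) := by
  have ht : 0 < t := hs.trans_lt hst
  have ha : 0 < (t + s) / (2 * t) := by positivity
  have hb : 0 < (t - s) / (2 * t) := div_pos (by linarith) (by linarith)
  have hab : (t + s) / (2 * t) + (t - s) / (2 * t) = 1 := by field_simp; ring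
  have hne : c + t * u ≠ c - t * u := fun h => by
    have : t * u = 0 := by linarith
    simp_all [ht.ne']
  have h1 := hf.2 (Set.mem_univ (c + t * u)) (Set.mem_univ (c - t * u)) hne ha hb hab
  have h2 := hf.2 (Set.mem_univ (c + t * u)) (Set.mem_univ (c - t * u)) hne hb ha (by linarith)
  simp only [smul_eq_mul] at h1 h2
  have e1 : (t + s) / (2 * t) * (c + t * u) + (t - s) / (2 * t) * (c - t * u) = c + s * u := by
    field_simp; ring
  have e2 : (t - s) / (2 * t) * (c + t * u) + (t + s) / (2 * t) * (c - t * u) = c - s * u := by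
    field_simp; ring
  rw [e1] at h1
  rw [e2] at h2
  linear_combination h1 + h2 + hab * (f (c + t * u) + f (c - t * u))

/-- The test function for the converse: strictly convex, yet of linear growth, so that finite means
make it integrable. -/
lemma strictConvexOn_sqrt_one_add_sq :
    StrictConvexOn ℝ Set.univ fun x : ℝ => Real.sqrt (1 + x ^ 2) := by
  refine ⟨convex_univ, fun x _ y _ hxy a b ha hb hab => ?_⟩
  have hx := Real.sq_sqrt (show 0 ≤ 1 + x ^ 2 by positivity)
  have hy := Real.sq_sqrt (show 0 ≤ 1 + y ^ 2 by positivity)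
  simp only [smul_eq_mul]
  set p := Real.sqrt (1 + x ^ 2) with hp
  set q := Real.sqrt (1 + y ^ 2) with hq
  -- Strict Cauchy–Schwarz for `(1, x)` and `(1, y)`; it bounds the cross term after squaring.
  have hpq : 1 + x * y < p * q := by
    refine lt_of_pow_lt_pow_left₀ 2 (by positivity) ?_
    have : 0 < (x - y) ^ 2 := by
      have := sub_ne_zero.mpr hxy
      positivity
    rw [mul_pow, hx, hy]
    linarith
  have hp0 : 0 < p := Real.sqrt_pos.mpr (by positivity)
  have hq0 : 0 < q := Real.sqrt_pos.mpr (by positivity)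
  rw [Real.sqrt_lt' (by positivity)]
  have h := mul_lt_mul_of_pos_left hpq (mul_pos ha hb)
  obtain rfl : b = 1 - a := by linarith
  linear_combination 2 * h - a ^ 2 * hx - (1 - a) ^ 2 * hy

lemma sqrt_one_add_sq_le (x : ℝ) : Real.sqrt (1 + x ^ 2) ≤ 1 + |x| := by
  rw [Real.sqrt_le_left (by positivity), ← sq_abs x]
  nlinarith [abs_nonneg x]

/-! ### Monotonicity of convex expectations under a reflection symmetry -/

section Reflection

variable {S : Type*} [MeasurableSpace S] {ν : Measure S} {ρ : S → S} {V U : S → ℝ}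

/-- If `U` changes sign under a measure-preserving map that fixes `V`, then `φ (V + s U)` may be
replaced by its even part in `s`. -/
lemma integrable_even_part (hρ : MeasurePreserving ρ ν ν) (hV : ∀ w, V (ρ w) = V w)
    (hU : ∀ w, U (ρ w) = -U w) {φ : ℝ → ℝ} {s : ℝ}
    (hi : Integrable (fun w => φ (V w + s * U w)) ν) :
    Integrable (fun w => φ (V w + s * U w) + φ (V w - s * U w)) ν ∧
      ∫ w, (φ (V w + s * U w) + φ (V w - s * U w)) ∂ν = 2 * ∫ w, φ (V w + s * U w) ∂ν := by
  have e : (fun w => φ (V w - s * U w)) = (fun w => φ (V w + s * U w)) ∘ ρ := by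
    funext w
    simp [hV, hU, sub_eq_add_neg]
  have hi' : Integrable (fun w => φ (V w - s * U w)) ν := by
    rw [e]
    exact hρ.integrable_comp_of_integrable hi
  refine ⟨hi.add hi', ?_⟩
  rw [integral_add hi hi', two_mul, add_right_inj, e]
  have h := hρ.map_eq
  conv_rhs => rw [← h]
  rw [integral_map hρ.aemeasurable (by rw [h]; exact hi.aestronglyMeasurable)]
  rfl

lemma integral_convex_mono (hρ : MeasurePreserving ρ ν ν) (hV : ∀ w, V (ρ w) = V w)
    (hU : ∀ w, U (ρ w) = -U w) {f : ℝ → ℝ} (hf : ConvexOn ℝ Set.univ f) {s t : ℝ}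
    (hs : 0 ≤ s) (hst : s ≤ t) (his : Integrable (fun w => f (V w + s * U w)) ν)
    (hit : Integrable (fun w => f (V w + t * U w)) ν) :
    ∫ w, f (V w + s * U w) ∂ν ≤ ∫ w, f (V w + t * U w) ∂ν := by
  obtain ⟨is, es⟩ := integrable_even_part hρ hV hU his
  obtain ⟨it, et⟩ := integrable_even_part hρ hV hU hit
  have := integral_mono is it fun w => convexOn_add_reflect_le hf (V w) (U w) hs hst
  linarith

lemma integral_strictConvex_lt (hρ : MeasurePreserving ρ ν ν) (hV : ∀ w, V (ρ w) = V w)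
    (hU : ∀ w, U (ρ w) = -U w) (hν : ν ≠ 0) (hU0 : ∀ᵐ w ∂ν, U w ≠ 0) {f : ℝ → ℝ}
    (hf : StrictConvexOn ℝ Set.univ f) {s t : ℝ}
    (hs : 0 ≤ s) (hst : s < t) (his : Integrable (fun w => f (V w + s * U w)) ν)
    (hit : Integrable (fun w => f (V w + t * U w)) ν) :
    ∫ w, f (V w + s * U w) ∂ν < ∫ w, f (V w + t * U w) ∂ν := by
  refine (integral_convex_mono hρ hV hU hf.convexOn hs hst.le his hit).lt_of_ne fun h => hν ?_
  obtain ⟨is, es⟩ := integrable_even_part hρ hV hU his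
  obtain ⟨it, et⟩ := integrable_even_part hρ hV hU hit
  -- Equal integrals of ordered even parts force equality almost everywhere, which strict convexity
  -- forbids where `U ≠ 0`.
  have hae := (integral_eq_iff_of_ae_le is it (.of_forall fun w =>
    convexOn_add_reflect_le hf.convexOn (V w) (U w) hs hst.le)).mp (by rw [es, et, h])
  have : ∀ᵐ _ ∂ν, False := by
    filter_upwards [hae, hU0] with w h1 h2
    exact (strictConvexOn_add_reflect_lt hf (V w) h2 hs hst).ne h1
  simpa using this

end Reflection


/-! ### Spherical laws and the half-space representation -/

/-- The spherical distribution on `ℝᵏ` with density generator `g`. -/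
def spherical (k : ℕ) (g : ℝ → ℝ) : Measure (EuclideanSpace ℝ (Fin k)) :=
  volume.withDensity fun w => ENNReal.ofReal (g (‖w‖ ^ 2))

lemma measurePreserving_spherical {k : ℕ} (g : ℝ → ℝ)
    (e : EuclideanSpace ℝ (Fin k) ≃ₗᵢ[ℝ] EuclideanSpace ℝ (Fin k)) :
    MeasurePreserving e (spherical k g) (spherical k g) := by
  have he : Measurable e := e.continuous.measurable
  refine ⟨he, Measure.ext fun s hs => ?_⟩
  rw [Measure.map_apply he hs, spherical, withDensity_apply _ hs, withDensity_apply _ (he hs)]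
  simpa using e.measurePreserving.setLIntegral_comp_preimage_emb
    e.toHomeomorph.measurableEmbedding (fun w => ENNReal.ofReal (g (‖w‖ ^ 2))) s

/-- The last `n` coordinates of a point of `ℝⁿ⁺¹`. -/
def tail {n : ℕ} (w : EuclideanSpace ℝ (Fin (n + 1))) : Fin n → ℝ := fun i => w i.succ

lemma continuous_tail {n : ℕ} : Continuous (tail (n := n)) := by
  unfold tail
  fun_prop

lemma norm_sq_eq_tail {n : ℕ} (w : EuclideanSpace ℝ (Fin (n + 1))) :
    ‖w‖ ^ 2 = tail w ⬝ᵥ tail w + w 0 ^ 2 := by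
  rw [EuclideanSpace.norm_sq_eq, Fin.sum_univ_succ, add_comm]
  simp [tail, dotProduct, sq]

lemma lintegral_eq_lintegral_tail {n : ℕ} {F : ℝ × (Fin n → ℝ) → ENNReal} (hF : Measurable F) :
    ∫⁻ w : EuclideanSpace ℝ (Fin (n + 1)), F (w 0, tail w) = ∫⁻ z, ∫⁻ t, F (t, z) := by
  have h := (volume_preserving_piFinSuccAbove (fun _ : Fin (n + 1) => ℝ) 0).comp
    (PiLp.volume_preserving_ofLp (Fin (n + 1)))
  rw [← lintegral_prod_symm' F hF, ← Measure.volume_eq_prod, ← h.lintegral_comp hF]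
  rfl

section Generator

variable {n : ℕ} {g : ℝ → ℝ}

lemma IsDensityGenerator.measurable_kernel (hg : IsDensityGenerator (n + 1) g) :
    Measurable fun p : ℝ × (Fin n → ℝ) => ENNReal.ofReal (g (p.2 ⬝ᵥ p.2 + p.1 ^ 2)) := by
  refine (hg.measurable.comp ?_).ennreal_ofReal
  unfold dotProduct
  fun_prop

lemma IsDensityGenerator.isProbabilityMeasure (hg : IsDensityGenerator (n + 1) g) :
    IsProbabilityMeasure (spherical (n + 1) g) := by
  constructor
  rw [spherical, withDensity_apply _ .univ, setLIntegral_univ, ← hg.lintegral_eq_one,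
    ← (PiLp.volume_preserving_ofLp (Fin (n + 1))).lintegral_comp_emb
      (MeasurableEquiv.toLp 2 (Fin (n + 1) → ℝ)).symm.measurableEmbedding]
  refine lintegral_congr fun w => ?_
  rw [EuclideanSpace.norm_sq_eq]
  simp [dotProduct, sq]

/-- Tonelli applied to the total mass 1. Off this full-measure set, the Bochner integral in
`marginalGenerator` takes the default value 0 and carries no information. -/
lemma IsDensityGenerator.ae_lt_top (hg : IsDensityGenerator (n + 1) g) :
    ∀ᵐ z : Fin n → ℝ, ∫⁻ t : ℝ, ENNReal.ofReal (g (z ⬝ᵥ z + t ^ 2)) < ⊤ := by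
  have := hg.isProbabilityMeasure
  have h1 : spherical (n + 1) g Set.univ = 1 := measure_univ
  rw [spherical, withDensity_apply _ .univ, setLIntegral_univ] at h1
  simp_rw [norm_sq_eq_tail] at h1
  rw [lintegral_eq_lintegral_tail hg.measurable_kernel] at h1
  refine MeasureTheory.ae_lt_top hg.measurable_kernel.lintegral_prod_left' ?_
  rw [h1]
  exact ENNReal.one_ne_top

/-- Where the marginal generator is finite, the factor `g⁽ⁿ⁾(q) F_{g_q}(s)` of the density is the
partial integral of `g (q + t²)`. -/
lemma IsDensityGenerator.ofReal_marginal_mul_cdf {m : ℕ} (hg : IsDensityGenerator m g) {q : ℝ}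
    (hq : 0 ≤ q) (hfin : ∫⁻ t : ℝ, ENNReal.ofReal (g (q + t ^ 2)) < ⊤) (s : ℝ) :
    ENNReal.ofReal (marginalGenerator g q * conditionalCDF g q s) =
      ∫⁻ t in Set.Iic s, ENNReal.ofReal (g (q + t ^ 2)) := by
  have hnn : ∀ t : ℝ, 0 ≤ g (q + t ^ 2) := fun t => hg.nonneg _ (by positivity)
  have hm : Measurable fun t : ℝ => g (q + t ^ 2) := hg.measurable.comp (by fun_prop)
  have hint : Integrable fun t : ℝ => g (q + t ^ 2) :=
    ⟨hm.aestronglyMeasurable, by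
      rwa [hasFiniteIntegral_iff_ofReal (.of_forall hnn)]⟩
  -- Here `conditionalCDF` divides by zero, but the nonnegative integrand has integral zero, so both
  -- sides vanish.
  by_cases h0 : marginalGenerator g q = 0
  · have h1 := ofReal_integral_eq_lintegral_ofReal hint (.of_forall hnn)
    rw [show ∫ t : ℝ, g (q + t ^ 2) = 0 from h0, ENNReal.ofReal_zero] at h1
    have h2 := setLIntegral_le_lintegral (μ := volume) (Set.Iic s)
      (fun t : ℝ => ENNReal.ofReal (g (q + t ^ 2)))
    rw [← h1, nonpos_iff_eq_zero] at h2
    rw [h0, h2, zero_mul, ENNReal.ofReal_zero]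
  · rw [conditionalCDF, mul_div_cancel₀ _ h0,
      ofReal_integral_eq_lintegral_ofReal hint.restrict (.of_forall hnn)]

end Generator

/-- Affine change of variables for lower Lebesgue integrals on `ℝⁿ`. -/
lemma lintegral_eq_det_mul_lintegral_affine {n : ℕ} (μ : Fin n → ℝ)
    {L : Matrix (Fin n) (Fin n) ℝ} (hL : L.det ≠ 0) (h : (Fin n → ℝ) → ENNReal) :
    ∫⁻ x, h x = ENNReal.ofReal |L.det| * ∫⁻ z, h (μ + L *ᵥ z) := by
  have hemb : MeasurableEmbedding (toLin' L) := by
    refine (LinearMap.isClosedEmbedding_of_injective ?_).measurableEmbedding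
    rw [LinearMap.ker_eq_bot]
    exact Matrix.mulVec_injective_iff_isUnit.mpr ((isUnit_iff_isUnit_det L).mpr hL.isUnit)
  have h1 := hemb.lintegral_map (μ := volume) fun y => h (μ + y)
  rw [Real.map_matrix_volume_pi_eq_smul_volume_pi hL, lintegral_smul_measure,
    lintegral_add_left_eq_self] at h1
  simp only [toLin'_apply] at h1
  rw [← h1, smul_eq_mul, ← mul_assoc, ← ENNReal.ofReal_mul (abs_nonneg _), ← abs_mul,
    mul_inv_cancel₀ hL]
  simp

open scoped MatrixOrder in
lemma exists_mul_transpose_of_posDef {n : ℕ} {Ω : Matrix (Fin n) (Fin n) ℝ} (hΩ : Ω.PosDef) :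
    ∃ L : Matrix (Fin n) (Fin n) ℝ, L * Lᵀ = Ω := by
  obtain ⟨B, hB⟩ := CStarAlgebra.nonneg_iff_eq_star_mul_self.mp hΩ.posSemidef.nonneg
  exact ⟨Bᵀ, by rw [hB, transpose_transpose, star_eq_conjTranspose,
    conjTranspose_eq_transpose_of_trivial]⟩

section Representation

variable {n : ℕ} {g : ℝ → ℝ}

/-- The substitution `x = μ + L z` turns `q(x)` into `z'z` and its Jacobian cancels `|Ω|^{-1/2}`.
What remains is twice the spherical mass of the half-space on the fibre over `z`. -/
lemma pdf_affine (hg : IsDensityGenerator (n + 1) g) (μ α : Fin n → ℝ)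
    {L : Matrix (Fin n) (Fin n) ℝ} (hL : L.det ≠ 0) {z : Fin n → ℝ}
    (hz : ∫⁻ t : ℝ, ENNReal.ofReal (g (z ⬝ᵥ z + t ^ 2)) < ⊤) :
    ENNReal.ofReal |L.det| * ENNReal.ofReal (pdf μ (L * Lᵀ) α g (μ + L *ᵥ z)) =
      2 * ∫⁻ t in Set.Iic ((Lᵀ *ᵥ α) ⬝ᵥ z), ENNReal.ofReal (g (z ⬝ᵥ z + t ^ 2)) := by
  have hq : (L *ᵥ z) ⬝ᵥ ((L * Lᵀ)⁻¹ *ᵥ (L *ᵥ z)) = z ⬝ᵥ z := by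
    have hu : IsUnit L.det := hL.isUnit
    have hut : IsUnit Lᵀ.det := by rwa [det_transpose]
    have e : Lᵀ * (L * Lᵀ)⁻¹ * L = 1 := by
      rw [Matrix.mul_inv_rev, mul_assoc, mul_assoc, nonsing_inv_mul _ hu, mul_one,
        mul_nonsing_inv _ hut]
    rw [dotProduct_comm, dotProduct_mulVec, ← mulVec_transpose, mulVec_mulVec, mulVec_mulVec, e,
      one_mulVec]
  have hα : α ⬝ᵥ (L *ᵥ z) = (Lᵀ *ᵥ α) ⬝ᵥ z := by
    rw [dotProduct_mulVec, ← mulVec_transpose]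
  have hdet : Real.sqrt (L * Lᵀ).det = |L.det| := by
    rw [det_mul, det_transpose, Real.sqrt_mul_self_eq_abs]
  rw [← hg.ofReal_marginal_mul_cdf (by simpa using dotProduct_star_self_nonneg z) hz, pdf,
    add_sub_cancel_left, hq, hα, hdet, ← ENNReal.ofReal_mul (abs_nonneg _),
    show (2 : ENNReal) = ENNReal.ofReal 2 by simp, ← ENNReal.ofReal_mul zero_le_two]
  congr 1
  have : |L.det| ≠ 0 := abs_ne_zero.mpr hL
  field_simp

/-- A skew-elliptical law is an affine image of the last `n` coordinates of a spherical
distribution on `ℝⁿ⁺¹` conditioned on a half-space. -/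
lemma law_eq_map (hg : IsDensityGenerator (n + 1) g) (μ α : Fin n → ℝ)
    {L : Matrix (Fin n) (Fin n) ℝ} (hL : L.det ≠ 0) :
    law μ (L * Lᵀ) α g =
      ((2 : ENNReal) • (spherical (n + 1) g).restrict {w | w 0 ≤ (Lᵀ *ᵥ α) ⬝ᵥ tail w}).map
        (fun w => μ + L *ᵥ tail w) := by
  classical
  set β := Lᵀ *ᵥ α with hβ
  have hT : Continuous fun z : Fin n → ℝ => μ + L *ᵥ z := by fun_prop
  have hTt : Measurable fun w : EuclideanSpace ℝ (Fin (n + 1)) => μ + L *ᵥ tail w :=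
    (hT.comp continuous_tail).measurable
  ext B hB
  have hD : MeasurableSet {p : ℝ × (Fin n → ℝ) | p.1 ≤ β ⬝ᵥ p.2} :=
    (isClosed_le continuous_fst (by fun_prop)).measurableSet
  have hBT : MeasurableSet {p : ℝ × (Fin n → ℝ) | μ + L *ᵥ p.2 ∈ B} :=
    (hT.measurable.comp measurable_snd) hB
  have hpair : Measurable fun w : EuclideanSpace ℝ (Fin (n + 1)) => (w 0, tail w) :=
    (by fun_prop : Measurable fun w : EuclideanSpace ℝ (Fin (n + 1)) => w 0).prodMk
      continuous_tail.measurable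
  have hS : MeasurableSet ((fun w => μ + L *ᵥ tail w) ⁻¹' B ∩
      {w : EuclideanSpace ℝ (Fin (n + 1)) | w 0 ≤ β ⬝ᵥ tail w}) := (hTt hB).inter (hpair hD)
  rw [Measure.map_apply hTt hB, Measure.smul_apply, Measure.restrict_apply (hTt hB), spherical,
    withDensity_apply _ hS, ← lintegral_indicator hS,
    law, withDensity_apply _ hB, ← lintegral_indicator hB,
    lintegral_eq_det_mul_lintegral_affine μ hL, ← lintegral_const_mul' _ _ ENNReal.ofReal_ne_top]
  have key := lintegral_eq_lintegral_tail (hg.measurable_kernel.indicator (hBT.inter hD))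
  have e1 : ∀ w : EuclideanSpace ℝ (Fin (n + 1)),
      ({p : ℝ × (Fin n → ℝ) | μ + L *ᵥ p.2 ∈ B} ∩ {p | p.1 ≤ β ⬝ᵥ p.2}).indicator
        (fun p => ENNReal.ofReal (g (p.2 ⬝ᵥ p.2 + p.1 ^ 2))) (w 0, tail w) =
      ((fun w => μ + L *ᵥ tail w) ⁻¹' B ∩ {w | w 0 ≤ β ⬝ᵥ tail w}).indicator
        (fun w => ENNReal.ofReal (g (‖w‖ ^ 2))) w := by
    intro w
    simp [Set.indicator_apply, norm_sq_eq_tail]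
  simp_rw [e1] at key
  rw [smul_eq_mul]
  refine Eq.trans ?_ (congrArg (2 * ·) key.symm)
  rw [← lintegral_const_mul' _ _ ENNReal.ofNat_ne_top]
  refine lintegral_congr_ae ?_
  filter_upwards [hg.ae_lt_top] with z hz
  by_cases hzB : μ + L *ᵥ z ∈ B
  · rw [Set.indicator_of_mem hzB, pdf_affine hg μ α hL hz, ← lintegral_indicator measurableSet_Iic]
    congr 1
    refine lintegral_congr fun t => ?_
    simp [Set.indicator_apply, hzB, hβ]
  · simp [hzB]

end Representation


/-! ### One-dimensional projections -/

/-- The spherical distribution on `ℝⁿ⁺¹` conditioned on a nonnegative first coordinate. -/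
def halfSpherical (n : ℕ) (g : ℝ → ℝ) : Measure (EuclideanSpace ℝ (Fin (n + 1))) :=
  (2 : ENNReal) • (spherical (n + 1) g).restrict {w | 0 ≤ w 0}

lemma measurableSet_coord_nonneg {n : ℕ} :
    MeasurableSet {w : EuclideanSpace ℝ (Fin (n + 1)) | 0 ≤ w 0} :=
  measurableSet_le measurable_const (by fun_prop)

lemma ae_halfSpherical_coord_ne_zero (n : ℕ) (g : ℝ → ℝ) (i : Fin (n + 1)) :
    ∀ᵐ w ∂halfSpherical n g, w i ≠ 0 := by
  have hac : halfSpherical n g ≪ volume :=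
    (Measure.smul_absolutelyContinuous.trans Measure.absolutelyContinuous_restrict).trans
      (withDensity_absolutelyContinuous _ _)
  suffices hvol : ∀ᵐ w : EuclideanSpace ℝ (Fin (n + 1)), w i ≠ 0 from hac.ae_le hvol
  have h := Measure.pi_hyperplane (fun _ : Fin (n + 1) => (volume : Measure ℝ)) i 0
  rw [← volume_pi] at h
  have h2 := (PiLp.volume_preserving_ofLp (Fin (n + 1))).quasiMeasurePreserving.preimage_null h
  simpa [ae_iff, Set.preimage] using h2

lemma ae_halfSpherical_coord_zero_pos (n : ℕ) (g : ℝ → ℝ) :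
    ∀ᵐ w ∂halfSpherical n g, 0 < w 0 := by
  have h : ∀ᵐ w ∂halfSpherical n g, 0 ≤ w 0 :=
    Measure.ae_smul_measure (ae_restrict_mem measurableSet_coord_nonneg) _
  filter_upwards [h, ae_halfSpherical_coord_ne_zero n g 0] with w h1 h2
  exact lt_of_le_of_ne h1 h2.symm

/-- The isometry of `ℝᵏ` that changes the sign of the coordinate `j`. -/
def flipCoord {k : ℕ} (j : Fin k) : EuclideanSpace ℝ (Fin k) ≃ₗᵢ[ℝ] EuclideanSpace ℝ (Fin k) :=
  LinearIsometryEquiv.piLpCongrRight 2 fun i =>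
    if i = j then LinearIsometryEquiv.neg ℝ else LinearIsometryEquiv.refl ℝ ℝ

lemma flipCoord_apply_self {k : ℕ} (j : Fin k) (w : EuclideanSpace ℝ (Fin k)) :
    flipCoord j w j = -w j := by
  simp [flipCoord]

lemma flipCoord_apply_of_ne {k : ℕ} {i j : Fin k} (h : i ≠ j) (w : EuclideanSpace ℝ (Fin k)) :
    flipCoord j w i = w i := by
  simp [flipCoord, h]

lemma measurePreserving_flipCoord {n : ℕ} (g : ℝ → ℝ) {j : Fin (n + 1)} (hj : j ≠ 0) :
    MeasurePreserving (flipCoord j) (halfSpherical n g) (halfSpherical n g) := by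
  have h := (measurePreserving_spherical g (flipCoord j)).restrict_preimage
    (measurableSet_coord_nonneg (n := n))
  have e : flipCoord j ⁻¹' {w : EuclideanSpace ℝ (Fin (n + 1)) | 0 ≤ w 0} = {w | 0 ≤ w 0} := by
    ext w
    simp [flipCoord_apply_of_ne hj.symm]
  rw [e] at h
  exact h.smul_measure _

lemma inner_toLp_cons {n : ℕ} (c : ℝ) (x : Fin n → ℝ) (w : EuclideanSpace ℝ (Fin (n + 1))) :
    inner ℝ (WithLp.toLp 2 (Fin.cons c x : Fin (n + 1) → ℝ)) w = c * w 0 + x ⬝ᵥ tail w := by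
  rw [PiLp.inner_apply, Fin.sum_univ_succ]
  simp [tail, dotProduct, mul_comm]

/-- Two vectors `v`, `u` with `‖v‖ = 1` and `u` not a multiple of `v` become `e₀` and
`⟪v, u⟫ e₀ + s e₁`, with `s > 0`, under an isometry. -/
lemma exists_isometry_coords {m : ℕ} {v u : EuclideanSpace ℝ (Fin (m + 2))} (hv : ‖v‖ = 1)
    (hu : u ≠ (inner ℝ v u : ℝ) • v) :
    ∃ (e : EuclideanSpace ℝ (Fin (m + 2)) ≃ₗᵢ[ℝ] EuclideanSpace ℝ (Fin (m + 2))) (s : ℝ), 0 < s ∧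
      s ^ 2 + (inner ℝ v u : ℝ) ^ 2 = ‖u‖ ^ 2 ∧
      (∀ w, inner ℝ v w = e w 0) ∧ ∀ w, inner ℝ u w = inner ℝ v u * e w 0 + s * e w 1 := by
  set d : ℝ := inner ℝ v u with hd
  set s : ℝ := ‖u - d • v‖ with hs
  have hs0 : 0 < s := norm_pos_iff.mpr (sub_ne_zero.mpr hu)
  have hvv : inner ℝ v v = (1 : ℝ) := by rw [real_inner_self_eq_norm_sq, hv, one_pow]
  have hort : inner ℝ v (u - d • v) = (0 : ℝ) := by
    rw [inner_sub_right, inner_smul_right, hvv, ← hd]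
    ring
  -- Gram–Schmidt on `v`, `u`. Only the values at 0 and 1 matter; the isometry takes coordinates in
  -- an orthonormal basis extending them.
  let F : Fin (m + 2) → EuclideanSpace ℝ (Fin (m + 2)) :=
    fun i => if i = 0 then v else s⁻¹ • (u - d • v)
  have hF : Orthonormal ℝ (({0, 1} : Set (Fin (m + 2))).domRestrict F) := by
    constructor
    · rintro ⟨i, rfl | rfl⟩
      · simpa [F] using hv
      · simp [F, norm_smul, ← hs, abs_of_pos hs0, hs0.ne']
    · rintro ⟨i, rfl | rfl⟩ ⟨j, rfl | rfl⟩ hij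
      · exact absurd rfl hij
      · simp [F, inner_smul_right, hort]
      · simp [F, inner_smul_left, real_inner_comm, hort]
      · exact absurd rfl hij
  obtain ⟨b, hb⟩ := hF.exists_orthonormalBasis_extension_of_card_eq (by simp)
  have hb0 : b 0 = v := by simpa [F] using hb 0 (by simp)
  have hb1 : b 1 = s⁻¹ • (u - d • v) := by simpa [F] using hb 1 (by simp)
  refine ⟨b.repr, s, hs0, ?_, fun w => ?_, fun w => ?_⟩
  · rw [hs, @norm_sub_sq_real, norm_smul, hv, inner_smul_right, real_inner_comm, ← hd, mul_one,
      Real.norm_eq_abs, sq_abs]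
    ring
  · rw [b.repr_apply_apply, hb0]
  · rw [b.repr_apply_apply, b.repr_apply_apply, hb0, hb1, inner_smul_left, inner_sub_left,
      inner_smul_left]
    simp only [conj_trivial]
    field_simp
    ring

/-- Every nontrivial linear functional of a skew-elliptical vector is distributed as
`a'μ + (a'δ_w) V + s U`, where `(V, U)` are the first two coordinates of the half-spherical
distribution and `s² + (a'δ_w)² = a'Ωa`. -/
lemma map_dotProduct_law {m : ℕ} {g : ℝ → ℝ} (hg : IsDensityGenerator (m + 1 + 1) g)
    (μ α : Fin (m + 1) → ℝ) {Ω : Matrix (Fin (m + 1)) (Fin (m + 1)) ℝ} (hΩ : Ω.PosDef)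
    {a : Fin (m + 1) → ℝ} (ha : a ≠ 0) :
    ∃ s : ℝ, 0 < s ∧ s ^ 2 + (a ⬝ᵥ skewness Ω α) ^ 2 = a ⬝ᵥ (Ω *ᵥ a) ∧
      (law μ Ω α g).map (fun x => a ⬝ᵥ x) =
        (halfSpherical (m + 1) g).map
          (fun w => a ⬝ᵥ μ + (a ⬝ᵥ skewness Ω α) * w 0 + s * w 1) := by
  obtain ⟨L, rfl⟩ := exists_mul_transpose_of_posDef hΩ
  have hL : L.det ≠ 0 := fun h => by
    have := hΩ.det_pos
    simp [h] at this
  have hquad : ∀ x y : Fin (m + 1) → ℝ, x ⬝ᵥ ((L * Lᵀ) *ᵥ y) = (Lᵀ *ᵥ x) ⬝ᵥ (Lᵀ *ᵥ y) := by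
    intro x y
    rw [← mulVec_mulVec, dotProduct_mulVec, ← mulVec_transpose]
  set β := Lᵀ *ᵥ α with hβ
  have hββ : 0 ≤ β ⬝ᵥ β := by simpa using dotProduct_star_self_nonneg β
  set r := Real.sqrt (1 + β ⬝ᵥ β) with hr
  have hr0 : 0 < r := Real.sqrt_pos.mpr (by positivity)
  have hr2 : r ^ 2 = 1 + β ⬝ᵥ β := Real.sq_sqrt (by positivity)
  have hδ : a ⬝ᵥ skewness (L * Lᵀ) α = r⁻¹ * (β ⬝ᵥ (Lᵀ *ᵥ a)) := by
    rw [skewness, dotProduct_smul, hquad, hquad, smul_eq_mul, ← hβ, ← hr, dotProduct_comm]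
  -- `v` is the unit inner normal of the conditioning half-space and `u` represents the functional
  -- `a'L` of the tail. Their inner product is `a'δ_w`.
  let v : EuclideanSpace ℝ (Fin (m + 1 + 1)) :=
    WithLp.toLp 2 (Fin.cons (-r⁻¹) (r⁻¹ • β) : Fin (m + 1 + 1) → ℝ)
  let u : EuclideanSpace ℝ (Fin (m + 1 + 1)) :=
    WithLp.toLp 2 (Fin.cons 0 (Lᵀ *ᵥ a) : Fin (m + 1 + 1) → ℝ)
  have hvw : ∀ w, inner ℝ v w = r⁻¹ * (β ⬝ᵥ tail w - w 0) := fun w => by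
    rw [inner_toLp_cons, smul_dotProduct, smul_eq_mul]
    ring
  have huw : ∀ w, inner ℝ u w = (Lᵀ *ᵥ a) ⬝ᵥ tail w := fun w => by
    rw [inner_toLp_cons, zero_mul, zero_add]
  have htu : tail u = Lᵀ *ᵥ a := rfl
  have htv : tail v = r⁻¹ • β := rfl
  have hu0 : u 0 = 0 := rfl
  have hv0 : v 0 = -r⁻¹ := rfl
  have hvn : ‖v‖ = 1 := by
    rw [← sq_eq_sq₀ (norm_nonneg _) zero_le_one, ← real_inner_self_eq_norm_sq, hvw, htv, hv0,
      dotProduct_smul, smul_eq_mul]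
    field_simp
    linarith
  have hun : ‖u‖ ^ 2 = a ⬝ᵥ ((L * Lᵀ) *ᵥ a) := by
    rw [← real_inner_self_eq_norm_sq, huw, htu, hquad]
  have hvu : inner ℝ v u = a ⬝ᵥ skewness (L * Lᵀ) α := by
    rw [hvw, htu, hu0, hδ, sub_zero]
  -- The zeroth coordinate vanishes for `u` but not for `v`, so proportionality would give `u = 0`
  -- and hence `a = 0`.
  have hne : u ≠ (inner ℝ v u : ℝ) • v := fun h => by
    have h0 : u 0 = inner ℝ v u * v 0 := congrArg (fun w : EuclideanSpace ℝ _ => w 0) h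
    have hd : inner ℝ v u = (0 : ℝ) := by
      rw [hu0, hv0] at h0
      simpa [hr0.ne'] using h0.symm
    rw [hd, zero_smul] at h
    have h1 : Lᵀ *ᵥ a = 0 := by
      rw [← htu, h]
      rfl
    refine ha (eq_zero_of_mulVec_eq_zero (by rwa [det_transpose]) h1)
  obtain ⟨e, s, hs, hs2, he0, he1⟩ := exists_isometry_coords hvn hne
  rw [hvu] at hs2 he1
  refine ⟨s, hs, by rw [hs2, hun], ?_⟩
  have hmp := (measurePreserving_spherical g e).restrict_preimage
    (measurableSet_coord_nonneg (n := m + 1))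
  have hset : e ⁻¹' {w | 0 ≤ w 0} = {w | w 0 ≤ β ⬝ᵥ tail w} := by
    ext w
    rw [Set.mem_preimage, Set.mem_ofPred_eq, Set.mem_ofPred_eq, ← he0, hvw,
      mul_nonneg_iff_of_pos_left (inv_pos.mpr hr0), sub_nonneg]
  have ht : Measurable fun w : EuclideanSpace ℝ (Fin (m + 1 + 1)) => μ + L *ᵥ tail w :=
    ((by fun_prop : Continuous fun z : Fin (m + 1) → ℝ => μ + L *ᵥ z).comp
      continuous_tail).measurable
  rw [law_eq_map hg μ α hL, Measure.map_map (by fun_prop) ht, halfSpherical, ← hmp.map_eq, hset,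
    Measure.map_smul, Measure.map_smul, Measure.map_map (by fun_prop) hmp.measurable]
  congr 2
  funext w
  simp only [Function.comp]
  rw [add_assoc, ← he1, huw, dotProduct_add, dotProduct_mulVec, ← mulVec_transpose]

lemma integrable_and_integral_of_map_eq {S T : Type*} [MeasurableSpace S] [MeasurableSpace T]
    {P : Measure S} {Q : Measure T} {A : S → ℝ} {B : T → ℝ} (hA : AEMeasurable A P)
    (hB : AEMeasurable B Q) (h : P.map A = Q.map B) {f : ℝ → ℝ} (hf : Measurable f) :
    (Integrable (fun s => f (A s)) P ↔ Integrable (fun t => f (B t)) Q) ∧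
      ∫ s, f (A s) ∂P = ∫ t, f (B t) ∂Q := by
  constructor
  · have h1 := integrable_map_measure (μ := P) hf.aestronglyMeasurable hA
    have h2 := integrable_map_measure (μ := Q) hf.aestronglyMeasurable hB
    rw [h] at h1
    exact h1.symm.trans h2
  · rw [← integral_map hA hf.aestronglyMeasurable, h, integral_map hB hf.aestronglyMeasurable]

/-- The representation of a linear functional of a skew-elliptical random vector at the level of
expectations. -/
lemma exists_integral_dotProduct {m : ℕ} {g : ℝ → ℝ} (hg : IsDensityGenerator (m + 1 + 1) g)
    {S : Type*} [MeasurableSpace S] {P : Measure S} {X : S → Fin (m + 1) → ℝ}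
    {μ α : Fin (m + 1) → ℝ} {Ω : Matrix (Fin (m + 1)) (Fin (m + 1)) ℝ} (hΩ : Ω.PosDef)
    (hX : HasLaw X (law μ Ω α g) P) {a : Fin (m + 1) → ℝ} (ha : a ≠ 0) :
    ∃ s : ℝ, 0 < s ∧ s ^ 2 + (a ⬝ᵥ skewness Ω α) ^ 2 = a ⬝ᵥ (Ω *ᵥ a) ∧
      ∀ f : ℝ → ℝ, Measurable f →
        (Integrable (fun x => f (a ⬝ᵥ X x)) P ↔ Integrable (fun w =>
          f (a ⬝ᵥ μ + (a ⬝ᵥ skewness Ω α) * w 0 + s * w 1)) (halfSpherical (m + 1) g)) ∧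
        ∫ x, f (a ⬝ᵥ X x) ∂P =
          ∫ w, f (a ⬝ᵥ μ + (a ⬝ᵥ skewness Ω α) * w 0 + s * w 1) ∂halfSpherical (m + 1) g := by
  obtain ⟨s, hs, hs2, hmap⟩ := map_dotProduct_law hg μ α hΩ ha
  have hd : Measurable fun x : Fin (m + 1) → ℝ => a ⬝ᵥ x := by fun_prop
  refine ⟨s, hs, hs2, fun f hf => integrable_and_integral_of_map_eq
    (hd.comp_aemeasurable hX.aemeasurable) (by fun_prop) ?_ hf⟩
  rw [← hmap, ← hX.map_eq, AEMeasurable.map_map_of_aemeasurable hd.aemeasurable hX.aemeasurable]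


/-! ### The two implications -/

section Order

variable {m : ℕ} {g : ℝ → ℝ} {S T : Type*} [MeasurableSpace S] [MeasurableSpace T]
  {P : Measure S} {Q : Measure T} {X : S → Fin (m + 1) → ℝ} {Y : T → Fin (m + 1) → ℝ}
  {μ αx αy : Fin (m + 1) → ℝ} {Ωx Ωy : Matrix (Fin (m + 1)) (Fin (m + 1)) ℝ}

lemma posLinearConvexOrder_of_isCopositive [IsProbabilityMeasure P] [IsProbabilityMeasure Q]
    (hg : IsDensityGenerator (m + 1 + 1) g)
    (hΩx : Ωx.PosDef) (hΩy : Ωy.PosDef) (hX : HasLaw X (law μ Ωx αx g) P)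
    (hY : HasLaw Y (law μ Ωy αy g) Q) (hδ : skewness Ωx αx = skewness Ωy αy)
    (hcop : IsCopositive (Ωy - Ωx)) : PosLinearConvexOrder P Q X Y := by
  intro a ha f hf hfX hfY
  rcases eq_or_ne a 0 with rfl | ha0
  · simp
  obtain ⟨s, hs, hs2, hPs⟩ := exists_integral_dotProduct hg hΩx hX ha0
  obtain ⟨t, ht, ht2, hQt⟩ := exists_integral_dotProduct hg hΩy hY ha0
  have hfm := measurable_of_convexOn hf
  rw [(hPs f hfm).1] at hfX
  rw [(hQt f hfm).1] at hfY
  rw [(hPs f hfm).2, (hQt f hfm).2]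
  rw [hδ] at hfX hs2 ⊢
  have hst : s ≤ t := by
    have h := hcop a ha
    rw [sub_mulVec, dotProduct_sub] at h
    exact (sq_le_sq₀ hs.le ht.le).mp (by linarith)
  exact integral_convex_mono (measurePreserving_flipCoord g (j := 1) (by simp))
    (V := fun w => a ⬝ᵥ μ + (a ⬝ᵥ skewness Ωy αy) * w 0) (U := fun w => w 1)
    (fun w => by simp [flipCoord_apply_of_ne]) (fun w => flipCoord_apply_self 1 w)
    hf hs.le hst hfX hfY

/-- The expectation of `c + d V + s U` under the half-spherical distribution does not depend
on `s`. -/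
lemma integral_halfSpherical_affine {c d s : ℝ}
    (hi : Integrable (fun w => c + d * w 0 + s * w 1) (halfSpherical (m + 1) g)) :
    Integrable (fun w => c + d * w 0) (halfSpherical (m + 1) g) ∧
      ∫ w, (c + d * w 0) ∂halfSpherical (m + 1) g =
        ∫ w, (c + d * w 0 + s * w 1) ∂halfSpherical (m + 1) g := by
  obtain ⟨h1, h2⟩ := integrable_even_part
    (measurePreserving_flipCoord g (j := (1 : Fin (m + 1 + 1))) (by simp))
    (V := fun w => c + d * w 0) (U := fun w => w 1)
    (fun w => by simp [flipCoord_apply_of_ne]) (fun w => flipCoord_apply_self 1 w)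
    (φ := fun x => x) hi
  have e : (fun w : EuclideanSpace ℝ (Fin (m + 1 + 1)) =>
      c + d * w 0 + s * w 1 + (c + d * w 0 - s * w 1)) = fun w => 2 * (c + d * w 0) := by
    funext w
    ring
  rw [e] at h1 h2
  rw [integral_const_mul] at h2
  refine ⟨?_, by linarith⟩
  simpa using h1.const_mul (2⁻¹ : ℝ)

lemma halfSpherical_ne_zero [IsProbabilityMeasure P] (hg : IsDensityGenerator (m + 1 + 1) g)
    (hΩx : Ωx.PosDef) (hX : HasLaw X (law μ Ωx αx g) P) : halfSpherical (m + 1) g ≠ 0 := by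
  obtain ⟨s, -, -, h⟩ := exists_integral_dotProduct hg hΩx hX (a := 1) one_ne_zero
  intro h0
  have := (h (fun _ => 1) measurable_const).2
  simp [h0] at this

lemma integrable_dotProduct (hX : ∀ i, Integrable (fun s => X s i) P) (a : Fin (m + 1) → ℝ) :
    Integrable (fun s => a ⬝ᵥ X s) P :=
  integrable_finsetSum _ fun i _ => (hX i).const_mul (a i)

lemma PosLinearConvexOrder.integral_eq (h : PosLinearConvexOrder P Q X Y)
    (hX : ∀ i, Integrable (fun s => X s i) P) (hY : ∀ i, Integrable (fun t => Y t i) Q)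
    {a : Fin (m + 1) → ℝ} (ha : ∀ i, 0 ≤ a i) :
    ∫ s, a ⬝ᵥ X s ∂P = ∫ t, a ⬝ᵥ Y t ∂Q := by
  have hiX := integrable_dotProduct hX a
  have hiY := integrable_dotProduct hY a
  -- Both the identity and its negative are convex.
  refine le_antisymm (h a ha (fun x => x) (convexOn_id convex_univ) hiX hiY) ?_
  have := h a ha (fun x => -x) (concaveOn_id convex_univ).neg hiX.neg hiY.neg
  rwa [integral_neg, integral_neg, neg_le_neg_iff] at this

lemma PosLinearConvexOrder.skewness_eq [IsProbabilityMeasure P]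
    (hg : IsDensityGenerator (m + 1 + 1) g)
    (hΩx : Ωx.PosDef) (hΩy : Ωy.PosDef) (hX : HasLaw X (law μ Ωx αx g) P)
    (hY : HasLaw Y (law μ Ωy αy g) Q) (hiX : ∀ i, Integrable (fun s => X s i) P)
    (hiY : ∀ i, Integrable (fun t => Y t i) Q) (h : PosLinearConvexOrder P Q X Y) :
    skewness Ωx αx = skewness Ωy αy := by
  funext i
  have ha : ∀ j, 0 ≤ (Pi.single i 1 : Fin (m + 1) → ℝ) j := fun j => by
    rw [Pi.single_apply]
    split_ifs <;> norm_num
  have ha0 : (Pi.single i 1 : Fin (m + 1) → ℝ) ≠ 0 := by simp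
  obtain ⟨s, -, -, hPs⟩ := exists_integral_dotProduct hg hΩx hX ha0
  obtain ⟨t, -, -, hQt⟩ := exists_integral_dotProduct hg hΩy hY ha0
  obtain ⟨e1, e2⟩ := hPs (fun x => x) measurable_id
  obtain ⟨e3, e4⟩ := hQt (fun x => x) measurable_id
  obtain ⟨i1, j1⟩ := integral_halfSpherical_affine (e1.mp (integrable_dotProduct hiX _))
  obtain ⟨i2, j2⟩ := integral_halfSpherical_affine (e3.mp (integrable_dotProduct hiY _))
  simp only [single_one_dotProduct] at *
  have hmean := h.integral_eq hiX hiY ha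
  simp only [single_one_dotProduct] at hmean
  by_contra hne
  have hc : skewness Ωx αx i - skewness Ωy αy i ≠ 0 := sub_ne_zero.mpr hne
  have hsub : (fun w : EuclideanSpace ℝ (Fin (m + 1 + 1)) =>
      μ i + skewness Ωx αx i * w 0 - (μ i + skewness Ωy αy i * w 0)) =
      fun w => (skewness Ωx αx i - skewness Ωy αy i) * w 0 := by
    funext w
    ring
  have h0 : ∫ w, w 0 ∂halfSpherical (m + 1) g = 0 := by
    have h1 := integral_sub i1 i2
    rw [hsub, integral_const_mul, j1, j2, ← e2, ← e4, hmean, sub_self] at h1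
    exact (mul_eq_zero.mp h1).resolve_left hc
  -- Integrability of `w 0` comes from the difference of the two representations, whose coefficient
  -- is nonzero.
  have hint : Integrable (fun w => w 0) (halfSpherical (m + 1) g) := by
    have h1 : Integrable (fun w => (skewness Ωx αx i - skewness Ωy αy i) * w 0)
        (halfSpherical (m + 1) g) := by
      rw [← hsub]
      exact i1.sub i2
    simpa [hc] using h1.const_mul (skewness Ωx αx i - skewness Ωy αy i)⁻¹
  have hpos := ae_halfSpherical_coord_zero_pos (m + 1) g
  have hae := (integral_eq_zero_iff_of_nonneg_ae (hpos.mono fun w hw => hw.le) hint).mp h0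
  have : ∀ᵐ _ ∂halfSpherical (m + 1) g, False := by
    filter_upwards [hae, hpos] with w h1 h2
    exact h2.ne' h1
  exact halfSpherical_ne_zero hg hΩx hX (by simpa using this)

lemma integrable_sqrt_one_add_sq {Z : S → ℝ} [IsFiniteMeasure P] (hZ : Integrable Z P) :
    Integrable (fun s => Real.sqrt (1 + Z s ^ 2)) P := by
  refine ((integrable_const (1 : ℝ)).add hZ.abs).mono'
    ((by fun_prop : Continuous fun x : ℝ => Real.sqrt (1 + x ^ 2)).comp_aestronglyMeasurable
      hZ.aestronglyMeasurable) (.of_forall fun s => ?_)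
  rw [Real.norm_of_nonneg (Real.sqrt_nonneg _)]
  exact sqrt_one_add_sq_le (Z s)

lemma PosLinearConvexOrder.isCopositive [IsProbabilityMeasure P] [IsProbabilityMeasure Q]
    (hg : IsDensityGenerator (m + 1 + 1) g)
    (hΩx : Ωx.PosDef) (hΩy : Ωy.PosDef) (hX : HasLaw X (law μ Ωx αx g) P)
    (hY : HasLaw Y (law μ Ωy αy g) Q) (hiX : ∀ i, Integrable (fun s => X s i) P)
    (hiY : ∀ i, Integrable (fun t => Y t i) Q) (h : PosLinearConvexOrder P Q X Y) :
    IsCopositive (Ωy - Ωx) := by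
  have hδ := h.skewness_eq hg hΩx hΩy hX hY hiX hiY
  intro a ha
  rcases eq_or_ne a 0 with rfl | ha0
  · simp
  obtain ⟨s, hs, hs2, hPs⟩ := exists_integral_dotProduct hg hΩx hX ha0
  obtain ⟨t, ht, ht2, hQt⟩ := exists_integral_dotProduct hg hΩy hY ha0
  rw [sub_mulVec, dotProduct_sub, ← hs2, ← ht2, hδ, add_sub_add_right_eq_sub, sub_nonneg,
    sq_le_sq₀ hs.le ht.le]
  by_contra! hts
  have hfX := integrable_sqrt_one_add_sq (integrable_dotProduct hiX a)
  have hfY := integrable_sqrt_one_add_sq (integrable_dotProduct hiY a)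
  have hle := h a ha _ strictConvexOn_sqrt_one_add_sq.convexOn hfX hfY
  have hfm := measurable_of_convexOn strictConvexOn_sqrt_one_add_sq.convexOn
  rw [(hPs _ hfm).1, hδ] at hfX
  rw [(hQt _ hfm).1] at hfY
  rw [(hPs _ hfm).2, (hQt _ hfm).2, hδ] at hle
  -- With `t < s` and the same `V`, the strict inequality runs against the assumed order.
  exact hle.not_gt <| integral_strictConvex_lt
    (measurePreserving_flipCoord g (j := 1) (by simp))
    (V := fun w => a ⬝ᵥ μ + (a ⬝ᵥ skewness Ωy αy) * w 0) (U := fun w => w 1)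
    (fun w => by simp [flipCoord_apply_of_ne]) (fun w => flipCoord_apply_self 1 w)
    (halfSpherical_ne_zero hg hΩx hX) (ae_halfSpherical_coord_ne_zero (m + 1) g 1)
    strictConvexOn_sqrt_one_add_sq ht.le hts hfY hfX

end Order

end SkewElliptical

end

theorem theorem3p11 {n : ℕ} {S T : Type*} [MeasurableSpace S] [MeasurableSpace T]
    (P : Measure S) [IsProbabilityMeasure P] (Q : Measure T) [IsProbabilityMeasure Q]
    (X : S → Fin n → ℝ) (Y : T → Fin n → ℝ)
    (μx μy αx αy : Fin n → ℝ) (Ωx Ωy : Matrix (Fin n) (Fin n) ℝ) (g : ℝ → ℝ)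
    (hg : SkewElliptical.IsDensityGenerator (n + 1) g)
    (hΩx : Ωx.PosDef) (hΩy : Ωy.PosDef)
    (hX : HasLaw X (SkewElliptical.law μx Ωx αx g) P)
    (hY : HasLaw Y (SkewElliptical.law μy Ωy αy g) Q) :
    (μx = μy →
      SkewElliptical.skewness Ωx αx = SkewElliptical.skewness Ωy αy →
      SkewElliptical.IsCopositive (Ωy - Ωx) →
      SkewElliptical.PosLinearConvexOrder P Q X Y) ∧
    ((∀ i, Integrable (fun s => X s i) P) →
      (∀ i, Integrable (fun t => Y t i) Q) →
      (∀ i, (P.map (fun s => X s i)).support = Set.univ) →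
      (∀ i, (Q.map (fun t => Y t i)).support = Set.univ) →
      SkewElliptical.PosLinearConvexOrder P Q X Y →
      μx = μy →
      SkewElliptical.skewness Ωx αx = SkewElliptical.skewness Ωy αy ∧
        SkewElliptical.IsCopositive (Ωy - Ωx)) := by

  cases n with
  -- The representation needs a second coordinate in `ℝⁿ⁺¹`; in dimension zero every functional is
  -- constantly 0.
  | zero =>
    refine ⟨fun _ _ _ a _ f _ _ _ => by simp [dotProduct], fun _ _ _ _ _ _ =>
      ⟨Subsingleton.elim _ _, fun x _ => by simp [dotProduct]⟩⟩
  | succ m =>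
    refine ⟨?_, ?_⟩
    · rintro rfl hδ hcop
      exact SkewElliptical.posLinearConvexOrder_of_isCopositive hg hΩx hΩy hX hY hδ hcop
    · rintro hiX hiY - - h rfl
      exact ⟨h.skewness_eq hg hΩx hΩy hX hY hiX hiY, h.isCopositive hg hΩx hΩy hX hY hiX hiY⟩
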